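/- Fix an algebraic closure $\overline{\mathbb{Q}}$ of $\mathbb{Q}$, and let all fields below be subfields of it. Let $H$ be the (non-logarithmic) absolute Weil height on $\overline{\mathbb{Q}}$. A subset $\mathcal{A}\subseteq\overline{\mathbb{Q}}$ has the Northcott property if for each positive real number $X$ there are only finitely many $\alpha\in\mathcal{A}$ with $H(\alpha)\le X$. For a number field $K$ write $\Delta_K$ for its absolute discriminant. Let $F_0$ be an arbitrary number field and let $F_1,F_2,F_3,\ldots$ be a sequence of field extensions of $F_0$ with $[F_i:F_0]\le 3$, such that for each positive integer $i$ there is a prime $p_i$ with $p_i\mid\Delta_{F_i}$ and $p_i\nmid\Delta_{F_j}$ for $0\le j<i$. Then the compositum of $F_0,F_1,F_2,F_3,\ldots$ has the Northcott property. -/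

import Mathlib

/-- A set `A` of algebraic numbers, inside a field `Ω` of characteristic zero, has the Northcott
property if for every positive real `X` only finitely many elements of `A` have (non-logarithmic)
absolute Weil height at most `X`. -/
def HasNorthcottProperty {Ω : Type*} [Field Ω] [CharZero Ω] (A : Set Ω) : Prop :=
  ∀ X : ℝ, 0 < X → {α : Ω | α ∈ A ∧ NumberField.absMulHeight₁ α ≤ X}.Finite

section

open NumberField Height Module
open scoped Pointwise

/-! Let `T n` be the compositum of `F 0, …, F n`. If α of height at most X lies in `T (k+1)` but not
in `T k`, the new prime p ramified in `F (k+1)` is bounded in terms of X and [F₀:ℚ] only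
(`NumberField.le_of_absMulHeight₁_le`). The new primes are distinct, so all such α lie in one number
field `T m`, where Northcott's theorem applies.

To bound p, let K = `T k` and let M be the normal closure of KF. Inertia groups above p fix K, but
some inertia group moves F. Since [F:F₀] ≤ 3, group theory gives α at most 3 conjugates over K, and
shows that at every prime in a Gal(M/F₀)-orbit above p, inertia carries one of them to a different
one. Those two are then close at that prime. By the product formula, closeness at many primes costs
height (`NumberField.prod_absNorm_le_of_apply_sub_lt`). The orbit is large because inertia has order
at most [F:ℚ]!, so p is bounded independently of [M:ℚ]. -/

/-! ### Liouville-type inequality for two close points. -/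

theorem NumberField.FinitePlace.apply_mul_absNorm_le_one {M : Type*} [Field M] [NumberField M]
    (w : FinitePlace M) {c : M} (hc : w c < 1) :
    w c * Ideal.absNorm w.maximalIdeal.asIdeal ≤ 1 := by
  rcases eq_or_ne c 0 with rfl | hc0
  · simp
  obtain ⟨r, s, hs, rfl⟩ := IsFractionRing.div_surjective (𝓞 M) c
  have hs0 : s ≠ 0 := nonZeroDivisors.ne_zero hs
  have hr0 : r ≠ 0 := by rintro rfl; simp at hc0
  have hr := w.apply_mul_absNorm_pow_eq_one hr0
  have hs := w.apply_mul_absNorm_pow_eq_one hs0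
  set N : ℝ := ((Ideal.absNorm w.maximalIdeal.asIdeal : ℕ) : ℝ) with hN
  have hN1 : 1 < N := by rw [hN]; exact_mod_cast HeightOneSpectrum.one_lt_absNorm w.maximalIdeal
  set m := multiplicity w.maximalIdeal.asIdeal (Ideal.span {r})
  set n := multiplicity w.maximalIdeal.asIdeal (Ideal.span {s})
  have hr' : w (algebraMap (𝓞 M) M r) = (N ^ m)⁻¹ := eq_inv_of_mul_eq_one_left hr
  have hs' : w (algebraMap (𝓞 M) M s) = (N ^ n)⁻¹ := eq_inv_of_mul_eq_one_left hs
  rw [map_div₀, hr', hs', div_inv_eq_mul, inv_mul_eq_div] at hc ⊢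
  have hpos : 0 < N ^ m := by positivity
  rw [div_lt_one hpos] at hc
  -- Discreteness: values of `w` are integral powers of `N`, so below 1 means at most 1/`N`.
  have hnm : n < m := (pow_lt_pow_iff_right₀ hN1).1 hc
  rw [div_mul_eq_mul_div, div_le_one hpos, ← pow_succ]
  exact pow_le_pow_right₀ hN1.le hnm

theorem NumberField.FinitePlace.exists_apply_eq_max_one {M : Type*} [Field M] [NumberField M]
    (w : FinitePlace M) (x : M) : ∃ b : M, b ≠ 0 ∧ w b = max (w x) 1 := by
  by_cases h : 1 ≤ w x
  · exact ⟨x, by rintro rfl; norm_num at h, (max_eq_left h).symm⟩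
  · exact ⟨1, one_ne_zero, by simp [max_eq_right (not_le.1 h).le]⟩

theorem NumberField.FinitePlace.apply_mul_absNorm_le_of_lt {M : Type*} [Field M] [NumberField M]
    (w : FinitePlace M) {x y z : M} (h : w z < max (w x) 1 * max (w y) 1) :
    w z * Ideal.absNorm w.maximalIdeal.asIdeal ≤ max (w x) 1 * max (w y) 1 := by
  obtain ⟨a, ha, hax⟩ := w.exists_apply_eq_max_one x
  obtain ⟨b, hb, hby⟩ := w.exists_apply_eq_max_one y
  have hab : 0 < w (a * b) := w.pos_iff.2 (mul_ne_zero ha hb)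
  rw [← hax, ← hby, ← map_mul] at h ⊢
  have h1 : w (z / (a * b)) < 1 := by rw [map_div₀]; exact (div_lt_one hab).2 h
  have := w.apply_mul_absNorm_le_one h1
  rwa [map_div₀, div_mul_eq_mul_div, div_le_one hab] at this

/-- Product formula for x - y: discreteness saves a factor of the norm at each place of `W`, the
ultrametric inequality handles the other finite places, and each archimedean place loses at most 2
per local degree. -/
theorem NumberField.prod_absNorm_le_of_apply_sub_lt {M : Type*} [Field M] [NumberField M]
    {x y : M} (hxy : x ≠ y) (W : Finset (FinitePlace M))
    (hW : ∀ w ∈ W, w (x - y) < max (w x) 1 * max (w y) 1) :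
    ∏ w ∈ W, (Ideal.absNorm w.maximalIdeal.asIdeal : ℝ) ≤
      2 ^ finrank ℚ M * (mulHeight₁ x * mulHeight₁ y) := by
  classical
  have hz : x - y ≠ 0 := sub_ne_zero.2 hxy
  have hfin (x : M) : (fun w : FinitePlace M ↦ max (w x) 1).HasFiniteMulSupport := by
    rcases eq_or_ne x 0 with rfl | hx
    · simp [Function.HasFiniteMulSupport, Function.mulSupport]
    · refine (FinitePlace.hasFiniteMulSupport hx).subset fun w hw ↦ ?_
      contrapose! hw
      simp_all
  let c : FinitePlace M → ℝ := fun w ↦ if w ∈ W then Ideal.absNorm w.maximalIdeal.asIdeal else 1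
  have hcs : Function.mulSupport c ⊆ W := fun w hw ↦ by
    by_contra h; exact hw (if_neg h)
  have hc : c.HasFiniteMulSupport := W.finite_toSet.subset hcs
  have hcW : ∏ᶠ w, c w = ∏ w ∈ W, (Ideal.absNorm w.maximalIdeal.asIdeal : ℝ) := by
    rw [finprod_eq_prod_of_mulSupport_subset _ hcs]
    exact Finset.prod_congr rfl fun w hw ↦ if_pos hw
  have hnonarch : (∏ᶠ w : FinitePlace M, w (x - y)) * ∏ᶠ w, c w ≤
      (∏ᶠ w : FinitePlace M, max (w x) 1) * ∏ᶠ w : FinitePlace M, max (w y) 1 := by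
    rw [← finprod_mul_distrib (FinitePlace.hasFiniteMulSupport hz) hc,
      ← finprod_mul_distrib (hfin x) (hfin y)]
    refine finprod_le_finprod ((FinitePlace.hasFiniteMulSupport hz).mul hc) (fun w ↦ ?_)
      ((hfin x).mul (hfin y)) (fun w ↦ ?_)
    · simp only [c]; positivity
    · simp only [c]
      split_ifs with h
      · exact w.apply_mul_absNorm_le_of_lt (hW w h)
      · have := FinitePlace.add_le w x (-y)
        rw [map_neg_eq_map, ← sub_eq_add_neg] at this
        rw [mul_one]
        refine this.trans (max_le ?_ ?_)
        · exact (le_max_left _ 1).trans (le_mul_of_one_le_right (by positivity) (le_max_right _ _))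
        · exact (le_max_left _ 1).trans (le_mul_of_one_le_left (by positivity) (le_max_right _ _))
  have harch : ∏ v : InfinitePlace M, v (x - y) ^ v.mult ≤
      2 ^ finrank ℚ M * ((∏ v : InfinitePlace M, max (v x) 1 ^ v.mult) *
        ∏ v : InfinitePlace M, max (v y) 1 ^ v.mult) := by
    rw [← InfinitePlace.sum_mult_eq, ← Finset.prod_pow_eq_pow_sum, ← Finset.prod_mul_distrib,
      ← Finset.prod_mul_distrib]
    refine Finset.prod_le_prod (fun v _ ↦ by positivity) fun v _ ↦ ?_
    rw [← mul_pow, ← mul_pow]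
    refine pow_le_pow_left₀ (by positivity) ?_ _
    have h1 : v (x - y) ≤ v x + v y := by
      have := v.1.add_le x (-y)
      rwa [v.1.map_neg, ← sub_eq_add_neg] at this
    have h2 := le_max_left (v x) 1
    have h3 := le_max_right (v x) 1
    have h4 := le_max_left (v y) 1
    have h5 := le_max_right (v y) 1
    nlinarith
  have hprod := prod_abs_eq_one hz
  rw [NumberField.mulHeight₁_eq, NumberField.mulHeight₁_eq, ← hcW]
  have h0 : 0 ≤ ∏ v : InfinitePlace M, v (x - y) ^ v.mult :=
    Finset.prod_nonneg fun v _ ↦ by positivity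
  have h1 : 0 ≤ (∏ᶠ w : FinitePlace M, w (x - y)) * ∏ᶠ w, c w :=
    mul_nonneg (finprod_nonneg fun w ↦ by positivity)
      (finprod_nonneg fun w ↦ by simp only [c]; positivity)
  calc ∏ᶠ w, c w = (∏ v : InfinitePlace M, v (x - y) ^ v.mult) *
        ((∏ᶠ w : FinitePlace M, w (x - y)) * ∏ᶠ w, c w) := by
        rw [← mul_assoc]
        exact (by simpa using congrArg (· * ∏ᶠ w, c w) hprod.symm)
    _ ≤ _ := mul_le_mul harch hnonarch h1 (h0.trans harch)
    _ = _ := by ring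

/-! ### Heights under extension of the number field. -/

theorem NumberField.InfinitePlace.prod_pow_mult_eq_prod_embeddings {K : Type*} [Field K]
    [NumberField K] (g : InfinitePlace K → ℝ) :
    ∏ v : InfinitePlace K, g v ^ v.mult = ∏ φ : K →+* ℂ, g (.mk φ) := by
  classical
  rw [← Finset.prod_fiberwise' Finset.univ InfinitePlace.mk g]
  refine Finset.prod_congr rfl fun v _ ↦ ?_
  rw [Finset.prod_const, InfinitePlace.card_filter_mk_eq]

theorem NumberField.prod_comp_algebraMap {K L : Type*} [Field K] [NumberField K] [Field L]
    [NumberField L] [Algebra K L] (g : (K →+* ℂ) → ℝ) :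
    ∏ φ : L →+* ℂ, g (φ.comp (algebraMap K L)) = (∏ φ : K →+* ℂ, g φ) ^ finrank K L := by
  classical
  rw [← Finset.prod_fiberwise' Finset.univ (fun φ : L →+* ℂ ↦ φ.comp (algebraMap K L)) g,
    ← Finset.prod_pow]
  refine Finset.prod_congr rfl fun ψ _ ↦ ?_
  rw [Finset.prod_const]
  congr 1
  let := ψ.toAlgebra
  rw [← AlgHom.card K L ℂ, ← Fintype.card_coe]
  refine Fintype.card_congr
    { toFun := fun φ ↦ { φ.1 with
        commutes' := fun r ↦ RingHom.congr_fun (Finset.mem_filter.1 φ.2).2 r }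
      invFun := fun φ ↦ ⟨φ.toRingHom, by
        simp only [Finset.mem_filter, Finset.mem_univ, true_and]
        exact φ.comp_algebraMap⟩
      left_inv := fun φ ↦ rfl
      right_inv := fun φ ↦ rfl }

theorem NumberField.absNorm_span_pair_mul_finprod {E : Type*} [Field E] [NumberField E] {n : ℕ}
    (hn : n ≠ 0) (c : 𝓞 E) :
    (Ideal.absNorm (Ideal.span {c, (n : 𝓞 E)}) : ℝ) *
      ∏ᶠ v : FinitePlace E, ⨆ i, v (![(c : E), (n : E)] i) = 1 := by
  have h : ![c, (n : 𝓞 E)] ≠ 0 := fun h ↦ hn (by simpa using congrFun h 1)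
  have := absNorm_mul_finprod_finitePlace_eq_one h
  rw [Matrix.range_cons_cons_empty] at this
  convert this using 6 with v i
  fin_cases i <;> simp

/-- Write x = a/n. The finite part of the height is the inverse norm of the ideal (a, n), and norms
of extended ideals are powers; at infinity, each embedding of K has [L:K] extensions. -/
theorem NumberField.mulHeight₁_algebraMap {K L : Type*} [Field K] [NumberField K] [Field L]
    [NumberField L] [Algebra K L] (x : K) :
    mulHeight₁ (algebraMap K L x) = mulHeight₁ x ^ finrank K L := by
  obtain ⟨n, hn, a, ha, -⟩ := exists_nat_ne_zero_exists_integer_mul_eq_and_absNorm_span_eq_pow x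
  have hnK : (n : K) ≠ 0 := mod_cast hn
  have hnL : (n : L) ≠ 0 := mod_cast hn
  have hx : x = a / (n : K) := by rw [← ha]; field_simp
  let b : 𝓞 L := algebraMap (𝓞 K) (𝓞 L) a
  have hb : algebraMap K L x = b / (n : L) := by
    rw [hx, map_div₀, map_natCast]; rfl
  have hideal : Ideal.absNorm (Ideal.span {b, (n : 𝓞 L)}) =
      Ideal.absNorm (Ideal.span {a, (n : 𝓞 K)}) ^ finrank K L := by
    have h1 : Ideal.span {b, (n : 𝓞 L)} =
        (Ideal.span {a, (n : 𝓞 K)}).map (algebraMap (𝓞 K) (𝓞 L)) := by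
      rw [Ideal.map_span, Set.image_pair, map_natCast]
    rw [h1, Ideal.absNorm_algebraMap, IsFractionRing.finrank_eq (𝓞 K) K (𝓞 L) L]
  have hfinK := absNorm_span_pair_mul_finprod hn a
  have hfinL := absNorm_span_pair_mul_finprod hn b
  rw [hideal, Nat.cast_pow] at hfinL
  rw [hb, hx, mulHeight₁_div_eq_mulHeight, mulHeight₁_div_eq_mulHeight,
    NumberField.mulHeight_eq (fun h ↦ hnK (by simpa using congrFun h 1)),
    NumberField.mulHeight_eq (fun h ↦ hnL (by simpa using congrFun h 1)), mul_pow,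
    eq_inv_of_mul_eq_one_right hfinK, eq_inv_of_mul_eq_one_right hfinL, inv_pow]
  congr 1
  rw [InfinitePlace.prod_pow_mult_eq_prod_embeddings, InfinitePlace.prod_pow_mult_eq_prod_embeddings,
    ← prod_comp_algebraMap]
  refine Finset.prod_congr rfl fun φ _ ↦ iSup_congr fun i ↦ ?_
  fin_cases i
  · simp [b]; rfl
  · simp

theorem NumberField.mulHeight₁_eq_absMulHeight₁_pow {Ω : Type*} [Field Ω] [CharZero Ω] {x : Ω}
    (hx : IsIntegral ℚ x) {M : Type*} [Field M] [NumberField M]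
    (f : IntermediateField.adjoin ℚ {x} →+* M) :
    mulHeight₁ (f (IntermediateField.AdjoinSimple.gen ℚ x)) =
      absMulHeight₁ x ^ finrank ℚ M := by
  have : FiniteDimensional ℚ (IntermediateField.adjoin ℚ {x}) :=
    IntermediateField.adjoin.finiteDimensional hx
  have : NumberField (IntermediateField.adjoin ℚ {x}) := {}
  let := f.toAlgebra
  have hdeg := finrank_mul_finrank ℚ (IntermediateField.adjoin ℚ {x}) M
  rw [absMulHeight₁, dif_pos hx, ← hdeg, pow_mul, Real.rpow_inv_natCast_pow (by positivity)
    finrank_pos.ne', ← mulHeight₁_algebraMap]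
  rfl

theorem NumberField.one_le_absMulHeight₁ {Ω : Type*} [Field Ω] [CharZero Ω] (x : Ω) :
    1 ≤ absMulHeight₁ x := by
  rw [absMulHeight₁]
  split_ifs with h
  · have : FiniteDimensional ℚ (IntermediateField.adjoin ℚ {x}) :=
      IntermediateField.adjoin.finiteDimensional h
    have : NumberField (IntermediateField.adjoin ℚ {x}) := {}
    exact Real.one_le_rpow (one_le_mulHeight₁ _) (by positivity)
  · rfl

/-! ### Group theory of index at most 3. -/

/-- The index of `HF` is 2 or 3, hence prime, so `HF` is maximal and the normal closure `V` of `J`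
satisfies `V`·`HF` = G. As `V` ≤ `HK`, `HF` has the same prime index in `HK`, which forces `HK ⊓ S`
= `HK ⊓ HF`. For τ = vh take ρ = v: the conjugates become hjh⁻¹, and if all lay in `S` they would
lie in `HF`, and so would `J`. -/
theorem Subgroup.exists_conj_notMem_of_index_le_three {G : Type*} [Group G]
    {HK HF S J : Subgroup G} (hF : HF.index ≤ 3) (hF0 : HF.index ≠ 0)
    (hJ : ∀ τ : G, ∀ j ∈ J, τ * j * τ⁻¹ ∈ HK) (hJF : ¬ J ≤ HF) (hS : HK ⊓ HF ≤ S)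
    (hKS : ¬ HK ≤ S) :
    S.relIndex HK ≤ 3 ∧
      ∀ τ : G, ∃ ρ ∈ HK, ∃ j ∈ J, ρ⁻¹ * (τ * j * τ⁻¹) * ρ ∉ S := by
  have hprime : HF.index.Prime := by
    have : HF.index ≠ 1 := fun h ↦ hJF (Subgroup.index_eq_one.1 h ▸ le_top)
    have : HF.index = 2 ∨ HF.index = 3 := by omega
    rcases this with h | h <;> rw [h] <;> norm_num
  have prime_le {A B : Subgroup G} {C : Subgroup G} (hp : (A.relIndex C).Prime) (hAB : A ≤ B)
      (hBC : B ≤ C) (hne : ¬ C ≤ B) : B ≤ A := by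
    have h := Subgroup.relIndex_mul_relIndex A B C hAB hBC
    rcases Nat.prime_mul_iff.1 (h ▸ hp) with h' | h'
    · exact absurd (Subgroup.relIndex_eq_one.1 h'.2) hne
    · exact Subgroup.relIndex_eq_one.1 h'.2
  set V := Subgroup.normalClosure (J : Set G) with hV
  have hJV : J ≤ V := Subgroup.le_normalClosure
  have hVK : V ≤ HK := by
    rw [hV, Subgroup.normalClosure, Subgroup.closure_le]
    intro x hx
    obtain ⟨j, hj, hjx⟩ := Group.mem_conjugatesOfSet_iff.1 hx
    obtain ⟨τ, rfl⟩ := isConj_iff.1 hjx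
    exact hJ τ j hj
  have hVF : V ⊔ HF = ⊤ := by
    by_contra hne
    refine hJF (hJV.trans (le_sup_left.trans (prime_le (C := ⊤) ?_ le_sup_right le_top
      (fun h ↦ hne (top_le_iff.1 h)))))
    rwa [Subgroup.relIndex_top_right]
  have hmul (g : G) : ∃ v ∈ V, ∃ h ∈ HF, v * h = g := by
    have : g ∈ ((V ⊔ HF : Subgroup G) : Set G) := by rw [hVF]; trivial
    rw [Subgroup.normal_mul] at this
    exact Set.mem_mul.1 this
  have hrel : HF.relIndex HK = HF.index := by
    have : MulAction.IsPretransitive HK (G ⧸ HF) := by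
      refine (MulAction.isPretransitive_iff_base ((1 : G) : G ⧸ HF)).2 fun y ↦ ?_
      induction y using QuotientGroup.induction_on with | H g =>
      obtain ⟨v, hv, h, hh, rfl⟩ := hmul g
      refine ⟨⟨v, hVK hv⟩, ?_⟩
      change ((v * 1 : G) : G ⧸ HF) = _
      rw [QuotientGroup.eq]
      simpa using hh
    have h := MulAction.index_stabilizer_of_transitive HK ((1 : G) : G ⧸ HF)
    rw [Subgroup.relIndex, Subgroup.index, Subgroup.index_eq_card HF, ← h, Subgroup.index]
    congr! 3
    ext x
    change _ ↔ ((x * 1 : G) : G ⧸ HF) = ((1 : G) : G ⧸ HF)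
    rw [Subgroup.mem_subgroupOf, eq_comm, QuotientGroup.eq]
    simp
  have hKF : HK ⊓ S ≤ HF := by
    refine (prime_le (A := HK ⊓ HF) (C := HK) ?_ (le_inf inf_le_left hS) inf_le_left
      (fun h ↦ hKS (h.trans inf_le_right))).trans inf_le_right
    rwa [Subgroup.inf_relIndex_left, hrel]
  refine ⟨?_, fun τ ↦ ?_⟩
  · have h := Subgroup.relIndex_mul_relIndex (HK ⊓ HF) (HK ⊓ S) HK (le_inf inf_le_left hS)
      inf_le_left
    rw [Subgroup.inf_relIndex_left, Subgroup.inf_relIndex_left, hrel] at h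
    exact (Nat.le_of_dvd (Nat.pos_of_ne_zero hF0) (Dvd.intro_left _ h)).trans hF
  · obtain ⟨ρ, hρ, h, hh, rfl⟩ := hmul τ
    by_contra! hcon
    refine hJF fun j hj ↦ ?_
    have h1 := hcon ρ (hVK hρ) j hj
    have h2 : h * j * h⁻¹ ∈ HK := hJ h j hj
    have h3 : h * j * h⁻¹ ∈ HF := hKF ⟨h2, by simpa [mul_assoc] using h1⟩
    have := HF.mul_mem (HF.mul_mem (HF.inv_mem hh) h3) hh
    convert this using 1
    group

theorem Subgroup.exists_conj_notMem_of_relIndex_le_three {G : Type*} [Group G]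
    {H HK HF S J : Subgroup G} (hKH : HK ≤ H) (hF : HF.relIndex H ≤ 3)
    (hF0 : HF.relIndex H ≠ 0) (hJ : ∀ τ ∈ H, ∀ j ∈ J, τ * j * τ⁻¹ ∈ HK) (hJF : ¬ J ≤ HF)
    (hS : HK ⊓ HF ≤ S) (hKS : ¬ HK ≤ S) :
    S.relIndex HK ≤ 3 ∧
      ∀ τ ∈ H, ∃ ρ ∈ HK, ∃ j ∈ J, ρ⁻¹ * (τ * j * τ⁻¹) * ρ ∉ S := by
  have hJH : J ≤ H := fun j hj ↦ hKH (by simpa using hJ 1 H.one_mem j hj)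
  have key := Subgroup.exists_conj_notMem_of_index_le_three (HK := HK.subgroupOf H)
    (HF := HF.subgroupOf H) (S := S.subgroupOf H) (J := J.subgroupOf H) hF hF0
    (fun τ j hj ↦ hJ τ τ.2 j hj) (fun h ↦ hJF fun j hj ↦ h (x := ⟨j, hJH hj⟩) hj)
    (fun x hx ↦ hS hx) (fun h ↦ hKS fun j hj ↦ h (x := ⟨j, hKH hj⟩) hj)
  rw [Subgroup.relIndex_subgroupOf hKH] at key
  refine ⟨key.1, fun τ hτ ↦ ?_⟩
  obtain ⟨ρ, hρ, j, hj, h⟩ := key.2 ⟨τ, hτ⟩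
  exact ⟨ρ, hρ, j, hj, h⟩

/-! ### Inertia groups: ramification and closeness of conjugates. -/

/-- Compare orders: the inertia group has order e(P/ℤ), its intersection with Gal(M/K) has order
e(P/𝓞 K), and e is multiplicative in towers. -/
theorem Ideal.inertia_le_fixingSubgroup_iff {M : Type*} [Field M] [NumberField M] [IsGalois ℚ M]
    (K : IntermediateField ℚ M) (P : Ideal (𝓞 M)) [P.IsPrime] :
    P.inertia Gal(M/ℚ) ≤ K.fixingSubgroup ↔ (P.under (𝓞 K)).ramificationIdx ℤ = 1 := by
  have : IsGaloisGroup K.fixingSubgroup K M := IsGaloisGroup.intermediateField _ _ _ _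
  have : IsGaloisGroup K.fixingSubgroup (𝓞 K) (𝓞 M) := .of_isFractionRing _ _ _ K M
  have : IsGaloisGroup Gal(M/ℚ) ℤ (𝓞 M) := .of_isFractionRing _ _ _ ℚ M
  have h1 : Nat.card (P.inertia Gal(M/ℚ)) = P.ramificationIdx ℤ := by
    rw [card_inertia_eq_ramificationIdxIn (P.under ℤ),
      ramificationIdxIn_eq_ramificationIdx (P.under ℤ) P Gal(M/ℚ)]
  have h2 : Nat.card (P.inertia Gal(M/ℚ) ⊓ K.fixingSubgroup : Subgroup Gal(M/ℚ)) =
      P.ramificationIdx (𝓞 K) := by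
    rw [← ramificationIdxIn_eq_ramificationIdx (P.under (𝓞 K)) P K.fixingSubgroup,
      ← card_inertia_eq_ramificationIdxIn (G := K.fixingSubgroup) (P.under (𝓞 K)) P,
      ← AddSubgroup.inertia_map_subtype]
    exact Nat.card_congr (Subgroup.equivMapOfInjective _ _
      (Subgroup.subtype_injective _)).symm.toEquiv
  have h3 := ramificationIdx_tower (R := ℤ) (P.under (𝓞 K)) P
  have h4 : 0 < P.ramificationIdx (𝓞 K) := P.ramificationIdx_pos _
  rw [← inf_eq_left]
  constructor
  · intro h
    rw [h, h1, h3] at h2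
    exact Nat.eq_of_mul_eq_mul_right h4 (by rw [h2, one_mul])
  · intro h
    refine Subgroup.eq_of_le_of_card_ge inf_le_left ?_
    rw [h1, h2, h3, h, one_mul]

theorem NumberField.not_dvd_discr_iff_inertia_le {M : Type*} [Field M] [NumberField M]
    [IsGalois ℚ M] (K : IntermediateField ℚ M) {p : ℕ} (hp : p.Prime) :
    ¬ (p : ℤ) ∣ discr K ↔ ∀ P : Ideal (𝓞 M), P.IsPrime → P.LiesOver (Ideal.span {(p : ℤ)}) →
      P.inertia Gal(M/ℚ) ≤ K.fixingSubgroup := by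
  rw [not_dvd_discr_iff_isUnramifiedIn K (𝓞 K) (Nat.prime_iff_prime_int.1 hp),
    Algebra.isUnramifiedIn_iff_forall_ramificationIdx_eq_one]
  constructor
  · intro h P _ _
    rw [P.inertia_le_fixingSubgroup_iff]
    have : (P.under (𝓞 K)).LiesOver (Ideal.span {(p : ℤ)}) := .tower_bot P _ _
    exact h _ this
  · intro h Q _ _
    obtain ⟨⟨P, _, hP⟩⟩ := (inferInstance : Nonempty (Q.primesOver (𝓞 M)))
    have : P.LiesOver (Ideal.span {(p : ℤ)}) := .trans P Q _
    have := h P inferInstance inferInstance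
    rwa [P.inertia_le_fixingSubgroup_iff, ← hP.over] at this

theorem Ideal.conj_mem_inertia_smul {G R : Type*} [Group G] [CommRing R] [MulSemiringAction G R]
    {P : Ideal R} {γ : G} (hγ : γ ∈ P.inertia G) (τ : G) :
    τ * γ * τ⁻¹ ∈ (τ • P).inertia G := by
  intro x
  have h : (τ * γ * τ⁻¹) • x - x = τ • (γ • τ⁻¹ • x - τ⁻¹ • x) := by
    rw [smul_sub, smul_inv_smul, mul_smul, mul_smul]
  rw [h]
  exact Ideal.smul_mem_pointwise_smul τ _ P (hγ _)

theorem NumberField.FinitePlace.apply_sub_lt_one_of_mem_inertia {M : Type*} [Field M]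
    [NumberField M] (w : FinitePlace M) {γ : Gal(M/ℚ)}
    (hγ : γ ∈ w.maximalIdeal.asIdeal.inertia Gal(M/ℚ)) {x : M} (hx : w x ≤ 1) :
    w (x - γ x) < 1 := by
  have hval : w.maximalIdeal.valuation M x ≤ 1 := by
    rw [← w.norm_embedding_eq, FinitePlace.norm_embedding, HeightOneSpectrum.adicAbv_def] at hx
    exact (WithZeroMulInt.toNNReal_le_one_iff
      (HeightOneSpectrum.one_lt_absNorm_nnreal w.maximalIdeal)).1 hx
  obtain ⟨r, ⟨s, hs⟩, hr⟩ := w.maximalIdeal.exists_primeCompl_mul_eq_of_integer x hval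
  have lt_one_iff (a : 𝓞 M) : w (algebraMap (𝓞 M) M a) < 1 ↔ a ∈ w.maximalIdeal.asIdeal := by
    rw [← w.norm_embedding_eq]
    exact FinitePlace.norm_lt_one_iff_mem M w.maximalIdeal a
  have eq_one_iff (a : 𝓞 M) : w (algebraMap (𝓞 M) M a) = 1 ↔ a ∉ w.maximalIdeal.asIdeal := by
    rw [← w.norm_embedding_eq]
    exact FinitePlace.norm_eq_one_iff_notMem M w.maximalIdeal a
  have hγs : γ • s ∉ w.maximalIdeal.asIdeal := fun h ↦
    hs (by simpa using w.maximalIdeal.asIdeal.sub_mem h (hγ s))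
  have hr' : γ x * algebraMap (𝓞 M) M (γ • s) = algebraMap (𝓞 M) M (γ • r) := by
    rw [algebraMap.smul', algebraMap.smul', ← hr]
    exact (map_mul γ _ _).symm
  have hmem : r * (γ • s - s) - (γ • r - r) * s ∈ w.maximalIdeal.asIdeal :=
    Ideal.sub_mem _ (Ideal.mul_mem_left _ _ (hγ s)) (Ideal.mul_mem_right _ _ (hγ r))
  -- With x = r/s and s a unit at `w`, clearing denominators leaves an element of the prime ideal.
  have heq : (x - γ x) * (algebraMap (𝓞 M) M s * algebraMap (𝓞 M) M (γ • s)) =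
      algebraMap (𝓞 M) M (r * (γ • s - s) - (γ • r - r) * s) := by
    simp only [map_sub, map_mul]
    rw [← hr', ← hr]
    ring
  have := (lt_one_iff _).2 hmem
  rwa [← heq, map_mul, map_mul, (eq_one_iff s).2 hs, (eq_one_iff _).2 hγs, mul_one, mul_one] at this

theorem NumberField.FinitePlace.apply_sub_lt_of_mem_inertia {M : Type*} [Field M]
    [NumberField M] (w : FinitePlace M) {γ : Gal(M/ℚ)}
    (hγ : γ ∈ w.maximalIdeal.asIdeal.inertia Gal(M/ℚ)) (x : M) :
    w (x - γ x) < max (w x) 1 * max (w (γ x)) 1 := by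
  rcases le_or_gt (w x) 1 with hx | hx
  · refine (w.apply_sub_lt_one_of_mem_inertia hγ hx).trans_le ?_
    exact one_le_mul_of_one_le_of_one_le (le_max_right _ _) (le_max_right _ _)
  -- A pole at `w` is treated by passing to x⁻¹, which is integral there.
  · have hx0 : x ≠ 0 := by rintro rfl; norm_num at hx
    have hγx0 : γ x ≠ 0 := by simpa using hx0
    have h1 : w (x⁻¹) ≤ 1 := by rw [map_inv₀]; exact inv_le_one_of_one_le₀ hx.le
    have h2 := w.apply_sub_lt_one_of_mem_inertia hγ h1
    have h3 : x - γ x = -(x⁻¹ - γ x⁻¹) * (x * γ x) := by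
      rw [map_inv₀]; field_simp; ring
    have h4 : 0 < w (x * γ x) := w.pos_iff.2 (mul_ne_zero hx0 hγx0)
    rw [h3, map_mul, map_neg_eq_map]
    refine (mul_lt_of_lt_one_left h4 h2).trans_le ?_
    rw [map_mul]
    gcongr <;> exact le_max_left _ _

/-! ### Bounding p inside a Galois number field. -/

theorem IntermediateField.relIndex_fixingSubgroup {k M : Type*} [Field k] [Field M] [Algebra k M]
    [FiniteDimensional k M] [IsGalois k M] {E F : IntermediateField k M} (h : E ≤ F) :
    F.fixingSubgroup.relIndex E.fixingSubgroup = relfinrank E F := by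
  have h1 := Subgroup.relIndex_mul_index (fixingSubgroup_le h)
  have h2 := finrank_bot_mul_relfinrank h
  rw [← finrank_eq_fixingSubgroup_index, ← finrank_eq_fixingSubgroup_index, ← h2, mul_comm] at h1
  exact Nat.eq_of_mul_eq_mul_left finrank_pos h1

/-- The kernel of the action on G/H is the normal core, so I acts faithfully on the cosets. -/
theorem Subgroup.card_le_factorial_of_inf_normalCore {G : Type*} [Group G] [Finite G]
    {I H : Subgroup G} (h : I ⊓ H.normalCore = ⊥) : Nat.card I ≤ H.index.factorial := by
  let f : I →* Equiv.Perm (G ⧸ H) := (MulAction.toPermHom G (G ⧸ H)).comp I.subtype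
  have hf : Function.Injective f := by
    rw [injective_iff_map_eq_one]
    intro x hx
    have : (x : G) ∈ I ⊓ H.normalCore :=
      ⟨x.2, by rw [Subgroup.normalCore_eq_ker]; exact hx⟩
    rw [h, Subgroup.mem_bot] at this
    exact Subtype.ext this
  rw [Subgroup.index_eq_card, ← Nat.card_perm]
  exact Nat.card_le_card_of_injective f hf

theorem MulAction.card_le_ncard_orbit_mul_card_stabilizer {G X : Type*} [Group G] [Finite G]
    [MulAction G X] (H : Subgroup G) (x : X) :
    Nat.card H ≤ (MulAction.orbit H x).ncard * Nat.card (MulAction.stabilizer G x) := by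
  rw [← MulAction.index_stabilizer, ← Subgroup.index_mul_card (MulAction.stabilizer H x)]
  refine Nat.mul_le_mul_left _ (Nat.card_le_card_of_injective
    (fun g : MulAction.stabilizer H x ↦ (⟨g.1.1, g.2⟩ : MulAction.stabilizer G x)) ?_)
  intro a b hab
  exact Subtype.ext (Subtype.ext (congrArg (fun z ↦ z.1) hab))

/-- Each place of `W` makes some ordered pair of distinct points of `A` close; sort the places by
pair and apply the two-point inequality to each pair. -/
theorem NumberField.prod_absNorm_le_of_forall_exists_inertia {M : Type*} [Field M] [NumberField M]
    (A : Finset M) {B : ℝ} (hB : ∀ x ∈ A, mulHeight₁ x ≤ B) (hB1 : 1 ≤ B)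
    (W : Finset (FinitePlace M))
    (hW : ∀ w ∈ W, ∃ γ ∈ w.maximalIdeal.asIdeal.inertia Gal(M/ℚ), ∃ x ∈ A, γ x ∈ A ∧ γ x ≠ x) :
    ∏ w ∈ W, (Ideal.absNorm w.maximalIdeal.asIdeal : ℝ) ≤
      (2 ^ finrank ℚ M * (B * B)) ^ (A.card * A.card) := by
  classical
  have hN (w : FinitePlace M) : (1 : ℝ) ≤ Ideal.absNorm w.maximalIdeal.asIdeal :=
    mod_cast (HeightOneSpectrum.one_lt_absNorm w.maximalIdeal).le
  have hbase : 1 ≤ 2 ^ finrank ℚ M * (B * B) :=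
    one_le_mul_of_one_le_of_one_le (one_le_pow₀ one_le_two) (one_le_mul_of_one_le_of_one_le hB1 hB1)
  let V (q : M × M) : Finset (FinitePlace M) :=
    W.filter fun w ↦ w (q.1 - q.2) < max (w q.1) 1 * max (w q.2) 1
  calc ∏ w ∈ W, (Ideal.absNorm w.maximalIdeal.asIdeal : ℝ)
      ≤ ∏ w ∈ W, ∏ q ∈ A.offDiag,
        if w ∈ V q then (Ideal.absNorm w.maximalIdeal.asIdeal : ℝ) else 1 := by
        refine Finset.prod_le_prod (fun w _ ↦ by positivity) fun w hw ↦ ?_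
        obtain ⟨γ, hγ, x, hx, hγx, hne⟩ := hW w hw
        have hq : (x, γ x) ∈ A.offDiag := Finset.mem_offDiag.2 ⟨hx, hγx, hne.symm⟩
        have hwV : w ∈ V (x, γ x) :=
          Finset.mem_filter.2 ⟨hw, w.apply_sub_lt_of_mem_inertia hγ x⟩
        rw [← Finset.mul_prod_erase _ _ hq, if_pos hwV]
        refine le_mul_of_one_le_right (by positivity) (Finset.one_le_prod fun q _ ↦ ?_)
        split_ifs
        exacts [hN w, le_rfl]
    _ = ∏ q ∈ A.offDiag, ∏ w ∈ V q, (Ideal.absNorm w.maximalIdeal.asIdeal : ℝ) := by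
        rw [Finset.prod_comm]
        refine Finset.prod_congr rfl fun q _ ↦ ?_
        rw [← Finset.prod_filter]
        congr 1
        ext w
        simp [V]
    _ ≤ ∏ q ∈ A.offDiag, (2 ^ finrank ℚ M * (B * B)) := by
        refine Finset.prod_le_prod (fun q _ ↦ by positivity) fun q hq ↦ ?_
        obtain ⟨h1, h2, h3⟩ := Finset.mem_offDiag.1 hq
        refine (prod_absNorm_le_of_apply_sub_lt h3 (V q)
          fun w hw ↦ (Finset.mem_filter.1 hw).2).trans ?_
        have := hB _ h1
        have := hB _ h2
        have := one_le_mulHeight₁ q.1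
        have := one_le_mulHeight₁ q.2
        gcongr
    _ ≤ _ := by
        rw [Finset.prod_const]
        refine pow_le_pow_right₀ hbase ?_
        rw [Finset.offDiag_card]
        exact Nat.sub_le _ _

theorem NumberField.pow_finrank_le_of_dvd_discr {M : Type*} [Field M] [NumberField M]
    [IsGalois ℚ M] {F₀ K F : IntermediateField ℚ M} (h0K : F₀ ≤ K) (h0F : F₀ ≤ F)
    (hdeg : IntermediateField.relfinrank F₀ F ≤ 3) {p : ℕ} (hp : p.Prime)
    (hK : ∀ P : Ideal (𝓞 M), P.IsPrime → P.LiesOver (Ideal.span {(p : ℤ)}) →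
      P.inertia Gal(M/ℚ) ≤ K.fixingSubgroup)
    (hF : (p : ℤ) ∣ discr F)
    (hM : K.fixingSubgroup.normalCore ⊓ F.fixingSubgroup.normalCore = ⊥)
    {α : M} (hα : α ∈ K ⊔ F) (hαK : α ∉ K) {B : ℝ}
    (hB : ∀ σ : Gal(M/ℚ), mulHeight₁ (σ α) ≤ B) :
    (p : ℝ) ^ finrank F₀ M ≤ (2 ^ finrank ℚ M * (B * B)) ^ (9 * (finrank ℚ F).factorial) := by
  classical
  obtain ⟨P₀, hP₀, hP₀p, hP₀F⟩ : ∃ P : Ideal (𝓞 M), P.IsPrime ∧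
      P.LiesOver (Ideal.span {(p : ℤ)}) ∧ ¬ P.inertia Gal(M/ℚ) ≤ F.fixingSubgroup := by
    have := mt (not_dvd_discr_iff_inertia_le F hp).2 (not_not.2 hF)
    push Not at this
    exact this
  have hpZ : Prime (p : ℤ) := Nat.prime_iff_prime_int.1 hp
  have : (Ideal.span {(p : ℤ)}).IsPrime := (Ideal.span_singleton_prime hpZ.ne_zero).2 hpZ
  have hpbot : Ideal.span {(p : ℤ)} ≠ ⊥ := by simpa using hp.ne_zero
  have : IsGaloisGroup Gal(M/ℚ) ℤ (𝓞 M) := .of_isFractionRing _ _ _ ℚ M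
  set I := P₀.inertia Gal(M/ℚ) with hI
  set S := MulAction.stabilizer Gal(M/ℚ) α with hS
  have hlies (τ : Gal(M/ℚ)) : (τ • P₀).LiesOver (Ideal.span {(p : ℤ)}) := inferInstance
  have hconj (τ : Gal(M/ℚ)) : ∀ γ ∈ I, τ * γ * τ⁻¹ ∈ K.fixingSubgroup := fun γ hγ ↦
    hK (τ • P₀) inferInstance (hlies τ) (Ideal.conj_mem_inertia_smul hγ τ)
  have hKS : ¬ K.fixingSubgroup ≤ S := fun h ↦ hαK <| by
    rw [← IsGalois.fixedField_fixingSubgroup K]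
    exact fun g ↦ h g.2
  have hKFS : K.fixingSubgroup ⊓ F.fixingSubgroup ≤ S := by
    rw [← IntermediateField.fixingSubgroup_sup]
    exact fun g hg ↦ hg ⟨α, hα⟩
  have hrel := IntermediateField.relIndex_fixingSubgroup h0F
  obtain ⟨hS3, hex⟩ := Subgroup.exists_conj_notMem_of_relIndex_le_three
    (IntermediateField.fixingSubgroup_le h0K) (hrel.trans_le hdeg)
    Subgroup.index_ne_zero_of_finite (fun τ _ ↦ hconj τ) hP₀F hKFS hKS
  have hAfin : (MulAction.orbit K.fixingSubgroup α).Finite := Set.finite_range _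
  let A : Finset M := hAfin.toFinset
  have hAcard : A.card ≤ 3 := by
    rw [← Set.ncard_eq_toFinset_card _ hAfin, ← MulAction.index_stabilizer]
    exact hS3
  set O := MulAction.orbit F₀.fixingSubgroup P₀ with hO
  have hOp (Q) (hQ : Q ∈ O) : Q.IsPrime ∧ Q.LiesOver (Ideal.span {(p : ℤ)}) := by
    obtain ⟨τ, rfl⟩ := hQ
    exact ⟨inferInstanceAs ((τ : Gal(M/ℚ)) • P₀).IsPrime, hlies τ⟩
  have hinj : Function.Injective fun w : FinitePlace M ↦ w.maximalIdeal.asIdeal :=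
    IsDedekindDomain.HeightOneSpectrum.asIdeal_injective.comp FinitePlace.maximalIdeal_injective
  have hOfin : O.Finite := Set.finite_range _
  have hWfin : ((fun w : FinitePlace M ↦ w.maximalIdeal.asIdeal) ⁻¹' O).Finite :=
    hOfin.preimage hinj.injOn
  let W := hWfin.toFinset
  have hWcard : W.card = O.ncard := by
    rw [← Set.ncard_eq_toFinset_card _ hWfin]
    refine Set.ncard_preimage_of_injective_subset_range hinj fun Q hQ ↦ ?_
    obtain ⟨_, _⟩ := hOp Q hQ
    exact ⟨FinitePlace.mk ⟨Q, inferInstance, Ideal.ne_bot_of_liesOver_of_ne_bot hpbot Q⟩,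
      congrArg _ (FinitePlace.maximalIdeal_mk _)⟩
  have hWmem (w) : w ∈ W ↔ w.maximalIdeal.asIdeal ∈ O := by simp [W]
  have hB1 : 1 ≤ B := (one_le_mulHeight₁ _).trans (hB 1)
  have hprod := prod_absNorm_le_of_forall_exists_inertia A (B := B) (by
      intro x hx
      obtain ⟨σ, rfl⟩ := hAfin.mem_toFinset.1 hx
      exact hB σ) hB1 W (by
      intro w hw
      obtain ⟨τ, hτ⟩ := (hWmem w).1 hw
      obtain ⟨ρ, hρ, γ, hγ, hγS⟩ := hex τ τ.2
      have hτγ := hconj τ γ hγ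
      -- The conjugated inertia element fixes K, hence permutes the K-conjugates of α, and it moves
      -- ρα because its ρ-conjugate is not in `S`.
      refine ⟨τ * γ * τ⁻¹, hτ ▸ Ideal.conj_mem_inertia_smul hγ _, ρ α,
        hAfin.mem_toFinset.2 ⟨⟨ρ, hρ⟩, rfl⟩,
        hAfin.mem_toFinset.2 ⟨⟨τ * γ * τ⁻¹ * ρ, mul_mem hτγ hρ⟩, rfl⟩, fun h ↦ hγS ?_⟩
      rw [hS, MulAction.mem_stabilizer_iff, mul_smul, mul_smul, inv_smul_eq_iff]
      exact h)
  have hnorm (w) (hw : w ∈ W) :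
      (Ideal.absNorm w.maximalIdeal.asIdeal : ℝ) = (p : ℝ) ^ P₀.inertiaDeg ℤ := by
    obtain ⟨τ, hτ⟩ := (hWmem w).1 hw
    have h1 : w.maximalIdeal.asIdeal = (τ : Gal(M/ℚ)) • P₀ := hτ.symm
    rw [h1, ← Ideal.inertiaDeg_smul ℤ P₀ (τ : Gal(M/ℚ))]
    have := hlies τ
    exact_mod_cast (Ideal.pow_inertiaDeg p ((τ : Gal(M/ℚ)) • P₀)).symm
  rw [Finset.prod_congr rfl hnorm, Finset.prod_const, ← pow_mul, hWcard] at hprod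
  have hstab := MulAction.card_le_ncard_orbit_mul_card_stabilizer F₀.fixingSubgroup P₀
  have hIcard : Nat.card I ≤ (finrank ℚ F).factorial := by
    rw [IntermediateField.finrank_eq_fixingSubgroup_index]
    refine Subgroup.card_le_factorial_of_inf_normalCore ?_
    rw [eq_bot_iff, ← hM]
    -- All conjugates of inertia fix K, so inertia lies in the normal core for K.
    exact inf_le_inf_right _ fun γ hγ τ ↦ hconj τ γ hγ
  rw [IsGalois.card_fixingSubgroup_eq_finrank, Ideal.card_stabilizer_eq_card_inertia_mul_finrank
    (Ideal.span {(p : ℤ)}) P₀] at hstab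
  have hp1 : (1 : ℝ) ≤ p := mod_cast hp.one_le
  have hbase : 1 ≤ 2 ^ finrank ℚ M * (B * B) :=
    one_le_mul_of_one_le_of_one_le (one_le_pow₀ one_le_two) (one_le_mul_of_one_le_of_one_le hB1 hB1)
  -- Orbit-stabilizer, with decomposition group of order f·|I|. The 9 in the final exponent is 3·3,
  -- from pairs of conjugates.
  calc (p : ℝ) ^ finrank F₀ M ≤ (p : ℝ) ^ (P₀.inertiaDeg ℤ * O.ncard * Nat.card I) :=
        pow_le_pow_right₀ hp1 (hstab.trans_eq (by ring))
    _ = ((p : ℝ) ^ (P₀.inertiaDeg ℤ * O.ncard)) ^ Nat.card I := pow_mul _ _ _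
    _ ≤ ((2 ^ finrank ℚ M * (B * B)) ^ (A.card * A.card)) ^ Nat.card I := by gcongr
    _ ≤ _ := by
        rw [← pow_mul]
        exact pow_le_pow_right₀ hbase (Nat.mul_le_mul (Nat.mul_le_mul hAcard hAcard) hIcard)

/-! ### Transfer to subfields of Ω and absolute heights. -/

theorem NumberField.discr_restrict {Ω : Type*} [Field Ω] [CharZero Ω]
    {E M : IntermediateField ℚ Ω} [NumberField E] [NumberField M] (h : E ≤ M) :
    discr (IntermediateField.restrict h) = discr E :=
  (discr_eq_discr_of_algEquiv _ (IntermediateField.restrictAlgEquiv h)).symm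

theorem NumberField.mulHeight₁_algEquiv_eq {Ω : Type*} [Field Ω] [CharZero Ω]
    {M : IntermediateField ℚ Ω} [NumberField M] (σ : Gal(M/ℚ)) (x : M) :
    mulHeight₁ (σ x) = absMulHeight₁ (x : Ω) ^ finrank ℚ M := by
  have hx : IsIntegral ℚ (x : Ω) := (IsIntegral.of_finite ℚ x).map M.val
  have hle : IntermediateField.adjoin ℚ {(x : Ω)} ≤ M := by
    rw [IntermediateField.adjoin_simple_le_iff]; exact x.2
  exact mulHeight₁_eq_absMulHeight₁_pow hx
    ((σ : M →+* M).comp (IntermediateField.inclusion hle : _ →+* M))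

theorem IntermediateField.restrict_le_iff_le_lift {k Ω : Type*} [Field k] [Field Ω] [Algebra k Ω]
    {E M : IntermediateField k Ω} (h : E ≤ M) (Z : IntermediateField k M) :
    restrict h ≤ Z ↔ E ≤ lift Z := by
  constructor
  · intro hle x hx
    exact (mem_lift (⟨x, h hx⟩ : M)).2 (hle ((mem_restrict h _).2 hx))
  · intro hle x hx
    exact (mem_lift x).1 (hle ((mem_restrict h x).1 hx))

/-- The fixed field of this normal subgroup is normal over k and contains K and F, so it is all of
M. -/
theorem IntermediateField.inf_normalCore_fixingSubgroup_restrict_eq_bot {k Ω : Type*} [Field k]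
    [Field Ω] [Algebra k Ω] [Normal k Ω] {K F M : IntermediateField k Ω} [FiniteDimensional k M]
    [IsGalois k M] (hK : K ≤ M) (hF : F ≤ M)
    (hM : M ≤ normalClosure k (K ⊔ F : IntermediateField k Ω) Ω) :
    (restrict hK).fixingSubgroup.normalCore ⊓ (restrict hF).fixingSubgroup.normalCore = ⊥ := by
  set N := (restrict hK).fixingSubgroup.normalCore ⊓ (restrict hF).fixingSubgroup.normalCore
  have : IsGalois k (fixedField N) := IsGalois.of_fixedField_normal_subgroup N
  have : Normal k (lift (fixedField N)) := Normal.of_algEquiv (liftAlgEquiv (fixedField N))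
  have hle : K ⊔ F ≤ lift (fixedField N) := by
    refine sup_le ?_ ?_
    · rw [← restrict_le_iff_le_lift hK, le_iff_le]
      exact inf_le_left.trans (Subgroup.normalCore_le _)
    · rw [← restrict_le_iff_le_lift hF, le_iff_le]
      exact inf_le_right.trans (Subgroup.normalCore_le _)
  have hMN : M ≤ lift (fixedField N) := hM.trans (normalClosure_le_iff_of_normal.2 hle)
  have htop : fixedField N = ⊤ := top_le_iff.1 fun x _ ↦ (mem_lift x).1 (hMN x.2)
  rw [← fixingSubgroup_fixedField N, htop, fixingSubgroup_top]

theorem NumberField.le_of_absMulHeight₁_le {Ω : Type*} [Field Ω] [CharZero Ω] [IsAlgClosure ℚ Ω]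
    {ι : Type*} [Finite ι] (E : ι → IntermediateField ℚ Ω) [∀ i, NumberField (E i)]
    {F₀ F : IntermediateField ℚ Ω} [NumberField F₀] [NumberField F]
    (h0K : F₀ ≤ ⨆ i, E i) (h0F : F₀ ≤ F) (hdeg : IntermediateField.relfinrank F₀ F ≤ 3)
    {p : ℕ} (hp : p.Prime) (hE : ∀ i, ¬ (p : ℤ) ∣ discr (E i)) (hF : (p : ℤ) ∣ discr F)
    {α : Ω} (hα : α ∈ (⨆ i, E i) ⊔ F) (hαK : α ∉ ⨆ i, E i) {X : ℝ} (hX : absMulHeight₁ α ≤ X) :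
    (p : ℝ) ≤ (2 * (X * X)) ^ (finrank ℚ F₀ * (9 * (finrank ℚ F₀ * 3).factorial)) := by
  have : Algebra.IsAlgebraic ℚ Ω := IsAlgClosure.isAlgebraic
  have : IsAlgClosed Ω := IsAlgClosure.isAlgClosed ℚ
  have : Normal ℚ Ω := IsAlgClosure.normal ℚ Ω
  set K := ⨆ i, E i with hKdef
  set M := IntermediateField.normalClosure ℚ (K ⊔ F : IntermediateField ℚ Ω) Ω with hMdef
  have : FiniteDimensional ℚ K := IntermediateField.finiteDimensional_iSup_of_finite
  have : FiniteDimensional ℚ (K ⊔ F : IntermediateField ℚ Ω) :=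
    IntermediateField.finiteDimensional_sup K F
  have : FiniteDimensional ℚ M := normalClosure.is_finiteDimensional ℚ _ Ω
  have : NumberField M := {}
  have : Normal ℚ M := normalClosure.normal ℚ _ Ω
  have : IsGalois ℚ M := {}
  have hLM : K ⊔ F ≤ M := IntermediateField.le_normalClosure _
  have hKM : K ≤ M := le_sup_left.trans hLM
  have hFM : F ≤ M := le_sup_right.trans hLM
  have h0M : F₀ ≤ M := h0F.trans hFM
  have hEM (i) : E i ≤ M := (le_iSup E i).trans hKM
  have hrestr {A : IntermediateField ℚ Ω} (h : A ≤ M) :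
      IntermediateField.restrict h = A.comap M.val := by
    ext x; exact IntermediateField.mem_restrict h x
  have hrel : (IntermediateField.restrict h0M).relfinrank (IntermediateField.restrict hFM) =
      F₀.relfinrank F := by
    rw [hrestr, hrestr]
    exact IntermediateField.relfinrank_comap_comap_eq_relfinrank_of_le _ _ M.val
      (by rwa [IntermediateField.fieldRange_val])
  have hdeg0 : finrank ℚ (IntermediateField.restrict h0M) = finrank ℚ F₀ :=
    (IntermediateField.restrictAlgEquiv h0M).toLinearEquiv.finrank_eq.symm
  have h0F' : IntermediateField.restrict h0M ≤ IntermediateField.restrict hFM := fun x hx ↦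
    (IntermediateField.mem_restrict hFM x).2 (h0F ((IntermediateField.mem_restrict h0M x).1 hx))
  have h0K' : IntermediateField.restrict h0M ≤ IntermediateField.restrict hKM := fun x hx ↦
    (IntermediateField.mem_restrict hKM x).2 (h0K ((IntermediateField.mem_restrict h0M x).1 hx))
  have hdegF : finrank ℚ (IntermediateField.restrict hFM) ≤ finrank ℚ F₀ * 3 := by
    rw [← IntermediateField.finrank_bot_mul_relfinrank h0F', hrel, hdeg0]
    exact Nat.mul_le_mul_left _ hdeg
  have hK' (P : Ideal (𝓞 M)) (_ : P.IsPrime) (_ : P.LiesOver (Ideal.span {(p : ℤ)})) :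
      P.inertia Gal(M/ℚ) ≤ (IntermediateField.restrict hKM).fixingSubgroup := by
    -- The fixed field of inertia contains every `E i`, hence their compositum: p stays unramified
    -- in K.
    have hle : IntermediateField.restrict hKM ≤
        IntermediateField.fixedField (P.inertia Gal(M/ℚ)) := by
      refine (IntermediateField.restrict_le_iff_le_lift hKM _).2 (iSup_le fun i ↦ ?_)
      refine (IntermediateField.restrict_le_iff_le_lift (hEM i) _).1
        ((IntermediateField.le_iff_le _ _).2 ?_)
      exact (not_dvd_discr_iff_inertia_le _ hp).1
        (fun h ↦ hE i (h.trans (dvd_of_eq (discr_restrict (hEM i))))) P inferInstance inferInstance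
    exact (IntermediateField.le_iff_le _ _).1 hle
  have hα' : (⟨α, hLM hα⟩ : M) ∈
      IntermediateField.restrict hKM ⊔ IntermediateField.restrict hFM := by
    have hle : K ⊔ F ≤ IntermediateField.lift
        (IntermediateField.restrict hKM ⊔ IntermediateField.restrict hFM) :=
      sup_le ((IntermediateField.restrict_le_iff_le_lift hKM _).1 le_sup_left)
        ((IntermediateField.restrict_le_iff_le_lift hFM _).1 le_sup_right)
    exact (IntermediateField.mem_lift (⟨α, hLM hα⟩ : M)).1 (hle hα)
  have hX0 : 1 ≤ X := (one_le_absMulHeight₁ α).trans hX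
  have key := pow_finrank_le_of_dvd_discr h0K' h0F' (hrel.trans_le hdeg) hp hK'
    (hF.trans (dvd_of_eq (discr_restrict hFM).symm))
    (IntermediateField.inf_normalCore_fixingSubgroup_restrict_eq_bot hKM hFM hMdef.le) hα'
    (fun h ↦ hαK ((IntermediateField.mem_restrict hKM _).1 h)) (B := X ^ finrank ℚ M)
    (fun σ ↦ (mulHeight₁_algEquiv_eq σ _).trans_le
      (pow_le_pow_left₀ (zero_le_one.trans (one_le_absMulHeight₁ α)) hX _))
  -- Both sides carry the exponent [M:F₀]; extracting that root removes all dependence on M.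
  have hmul := finrank_mul_finrank ℚ (IntermediateField.restrict h0M) M
  rw [← mul_pow, ← mul_pow, ← hmul, hdeg0] at key
  have hbase : 1 ≤ 2 * (X * X) := by nlinarith
  refine le_of_pow_le_pow_left₀ (n := finrank (IntermediateField.restrict h0M) M)
    finrank_pos.ne' (by positivity) (key.trans ?_)
  rw [← pow_mul, ← pow_mul]
  refine pow_le_pow_right₀ hbase ?_
  rw [mul_right_comm]
  gcongr
  exact hdegF

theorem NumberField.finite_setOf_mem_absMulHeight₁_le {Ω : Type*} [Field Ω] [CharZero Ω]
    (K : IntermediateField ℚ Ω) [NumberField K] (X : ℝ) :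
    {α : Ω | α ∈ K ∧ absMulHeight₁ α ≤ X}.Finite := by
  refine ((finite_setOfPred_mulHeight₁_le K (X ^ finrank ℚ K)).image (fun x : K ↦ (x : Ω))).subset ?_
  rintro α ⟨hα, hX⟩
  refine ⟨⟨α, hα⟩, ?_, rfl⟩
  exact (mulHeight₁_algEquiv_eq (1 : Gal(K/ℚ)) ⟨α, hα⟩).trans_le
    (pow_le_pow_left₀ (zero_le_one.trans (one_le_absMulHeight₁ α)) hX _)

end

/-! ### The Northcott property of the compositum. -/

theorem corollary1p8 {Ω : Type*} [Field Ω] [CharZero Ω] [IsAlgClosure ℚ Ω]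
    (F : ℕ → IntermediateField ℚ Ω) [∀ i, NumberField (F i)]
    (hle : ∀ i, F 0 ≤ F i)
    (hdeg : ∀ i, IntermediateField.relfinrank (F 0) (F i) ≤ 3)
    (hram : ∀ i, 1 ≤ i → ∃ p : ℕ, p.Prime ∧ (p : ℤ) ∣ NumberField.discr (F i) ∧
      ∀ j, j < i → ¬ (p : ℤ) ∣ NumberField.discr (F j)) :
    HasNorthcottProperty ((⨆ i, F i : IntermediateField ℚ Ω) : Set Ω) := by
  intro X _
  -- Index shift: `p i` is the new prime of `F (i + 1)`.
  choose p hp hdvd hndvd using fun i : ℕ ↦ hram (i + 1) (Nat.le_add_left 1 i)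
  have hpinj : Function.Injective p := by
    intro a b hab
    by_contra hne
    rcases Nat.lt_or_gt_of_ne hne with h | h
    · exact hndvd b (a + 1) (by omega) (hab ▸ hdvd a)
    · exact hndvd a (b + 1) (by omega) (hab ▸ hdvd b)
  let T (n : ℕ) : IntermediateField ℚ Ω := ⨆ j : Fin (n + 1), F j
  have hFT {i n : ℕ} (h : i ≤ n) : F i ≤ T n :=
    le_iSup (fun j : Fin (n + 1) ↦ F j) ⟨i, Nat.lt_succ_of_le h⟩
  have hT : Monotone T := fun a b hab ↦ iSup_le fun j ↦ hFT ((Nat.le_of_lt_succ j.2).trans hab)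
  have hTfin (n : ℕ) : NumberField (T n) :=
    { to_finiteDimensional := IntermediateField.finiteDimensional_iSup_of_finite }
  set C : ℝ := (2 * (X * X)) ^ (Module.finrank ℚ (F 0) *
    (9 * (Module.finrank ℚ (F 0) * 3).factorial))
  obtain ⟨m, hm⟩ : ∃ m, ∀ i, (p i : ℝ) ≤ C → i + 1 ≤ m := by
    have hfin : (p ⁻¹' Set.Iic ⌊C⌋₊).Finite := (Set.finite_Iic _).preimage hpinj.injOn
    obtain ⟨m, hm⟩ := hfin.bddAbove
    exact ⟨m + 1, fun i hi ↦ Nat.succ_le_succ (hm (Nat.le_floor hi))⟩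
  refine (NumberField.finite_setOf_mem_absMulHeight₁_le (T m) X).subset ?_
  rintro α ⟨hα, hαX⟩
  refine ⟨?_, hαX⟩
  have hex : ∃ n, α ∈ T n := by
    have hsup : ⨆ i, F i ≤ ⨆ n, T n := iSup_mono fun i ↦ hFT le_rfl
    have := hsup hα
    rw [← SetLike.mem_coe, IntermediateField.coe_iSup_of_directed hT.directed_le] at this
    exact Set.mem_iUnion.1 this
  classical
  have hmem := Nat.find_spec hex
  have hmin (k) (hk : k < Nat.find hex) : α ∉ T k := Nat.find_min hex hk
  -- At the least level k + 1 containing α, the prime `p k` is at most `C`, so k + 1 ≤ m.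
  rcases hn : Nat.find hex with _ | k
  · exact hT (Nat.zero_le m) (hn ▸ hmem)
  · rw [hn] at hmem
    refine hT (hm k ?_) hmem
    refine NumberField.le_of_absMulHeight₁_le (fun j : Fin (k + 1) ↦ F j) (hFT (Nat.zero_le k))
      (hle (k + 1)) (hdeg _) (hp k) (fun j ↦ hndvd k j j.2) (hdvd k) ?_ (hmin k (by omega)) hαX
    have : T (k + 1) ≤ T k ⊔ F (k + 1) := by
      refine iSup_le fun j ↦ ?_
      rcases Nat.lt_succ_iff_lt_or_eq.1 j.2 with h | h
      · exact (hFT (Nat.le_of_lt_succ h)).trans le_sup_left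
      · rw [h]; exact le_sup_right
    exact this hmem
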